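/- **Setting.** $N$ agents with sensing ranges $r_j>0$ move in $[0,L]$ and monitor $M$ targets at $x_i\in[0,L]$ over the horizon $[0,T]$, $T>0$. Agent $j$ starts at $s_j(0)\in[0,L]$ and has switching points $\theta_j=(\theta_{j1},\dots,\theta_{j\Gamma_j})$ and dwell times $w_j=(w_{j1},\dots,w_{j\Gamma_j})$: it moves at unit speed to $\theta_{j1}$, stays there for time $w_{j1}$, moves to $\theta_{j2}$, and so on, and stays at its last switching point. This gives its control $u_j(t)\in\{-1,0,1\}$ and its position $s_j(t)=s_j(0)+\int_0^t u_j$. Parameters are feasible if all $\theta_{jl}\in[0,L]$ and all $w_{jl}\ge 0$. Let $p_{ij}(s)=\max\{0,1-|x_i-s|/r_j\}$ and $P_i(t)=1-\prod_j(1-p_{ij}(s_j(t)))$. The uncertainty $R_i\ge 0$ of target $i$ starts at a given $R_i(0)\ge 0$ and satisfies $\dot R_i=0$ if $R_i=0$ and $A_i\le B_iP_i$, and $\dot R_i=A_i-B_iP_i$ otherwise, where $0<A_i<B_i$. The cost is $J(\theta,w)=\frac1T\int_0^T\sum_iR_i(t)\,dt$. Put $\mathcal T_j(t)=\{i:|x_i-s_j(t)|\le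 r_j\}$ and $\mathcal N_{ij}(t)=\{k\ne j:|s_k(t)-x_i|\le r_k\}$. **IPA gradient.** For a scalar parameter $c$ of agent $j$, $\partial s_j/\partial c$ is $0$ initially, is constant between the control switches of agent $j$, and changes at these as follows. At a switch $\pm1\to0$ at $\theta_{j\xi}$ it becomes $1$ for $c=\theta_{j\xi}$ and $0$ for every other $c$. At a switch $0\to u$ with $u=\pm1$, put $\sigma_l=\mathrm{sgn}(\theta_{jl}-\theta_{j(l-1)})$ with $\theta_{j0}=s_j(0)$; then $u\sigma_\xi$ is subtracted for $c=\theta_{j\xi}$, $u(\sigma_l-\sigma_{l+1})$ is subtracted for $c=\theta_{jl}$, $l<\xi$, and the value becomes $-u$ for $c=w_{jl}$, $l\le\xi$. (Passing through $\theta_{j\xi}$ with $w_{j\xi}=0$ without reversing counts as a switch $\pm1\to0$ followed at once by a switch $0\to\pm1$.) At a direct reversal $\pm1\to\mp1$ it becomes $2$ for $c=\theta_{j\xi}$ and changes sign for every other $c$. The derivative $\partial R_i/\partial c$ is $0$ at $t=0$, is reset to $0$ whenever $R_i$ hits $0$, and otherwise is continuous and satisfies $\frac{d}{dt}\frac{\partial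 R_i}{\partial c}=0$ while $R_i=0$ and $A_i\le B_iP_i$, and $\frac{d}{dt}\frac{\partial R_i}{\partial c}=-B_i\,p_{ij}'(s_j)\,\frac{\partial s_j}{\partial c}\prod_{g\in\mathcal N_{ij}(t)}(1-p_{ig}(s_g))$ otherwise, where $p_{ij}'(s)=\mathrm{sgn}(x_i-s)/r_j$ for $|x_i-s|<r_j$ and $p_{ij}'(s)=0$ otherwise. The gradient is $\nabla_jJ=\frac1T\sum_i\int_0^T\nabla_jR_i(t)\,dt$. **Events and information.** The events are $\rho_i^0,\rho_i^+$ ($R_i$ hits or leaves $0$), $\pi_{ij}^0,\pi_{ij}^+$ ($p_{ij}(s_j(t))$ hits or leaves $0$), $\nu_j^{(u,v)}$ ($u_j$ switches from $u$ to $v\neq u$) and $\Delta_{ij}^{\pm}$ (an agent joins or leaves $\mathcal N_{ij}$). Let $\mathcal E_j(t)$ consist of all events $\nu_j^{(\cdot,\cdot)}$ and, for all $i\in\mathcal T_j(t)$, all other events of target $i$; the local information set is $I_j(t)=\mathcal E_j(t)\cup\bigcup_{i\in\mathcal T_j(t),\,k\in\mathcal N_{ij}(t)}\mathcal E_k(t)$.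 At each time $t$, agent $j$ gets to know which events of $I_j(t)$ occur, and, in accordance with its sensing and communication abilities, its own position, the states $R_i(t)$ for $i\in\mathcal T_j(t)$ and the positions $s_k(t)$ of its collaborators $k\in\mathcal N_{ij}(t)$, $i\in\mathcal T_j(t)$; in addition it gets to know which events $\rho_i^0$ with $i\notin\mathcal T_j(t)$ occur. **Theorem 1.** There are maps $F_j$ $(j=1,\dots,N)$, depending only on the constants $L,T,x_i,r_j,A_i,B_i,\Gamma_j$, and taking as arguments only agent $j$'s own parameters and the information that agent $j$ gets to know during $[0,T]$ as just described, such that the following holds for all initial positions $s_j(0)\in[0,L]$, all initial uncertainties $R_i(0)\ge0$ and all step sizes $\alpha_\theta^l,\alpha_w^l$ (in particular for diminishing ones). Let $(\theta^l,w^l)_{l\ge 0}$ be a finite or infinite sequence of iterates of the centralized gradient descent $[\theta^{l+1},w^{l+1}]=[\theta^l,w^l]-[\alpha_\theta^l,\alpha_w^l]\nabla J(\theta^l,w^l)$, where all iterates at which the gradient is taken are feasible. Then the decentralized updates $$[\theta_j^{l+1},w_j^{l+1}]=[\theta_j^l,w_j^l]-[\alpha_\theta^l,\alpha_w^l]\,F_j,\qquad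 j=1,\dots,N,$$ in which $F_j$ is evaluated at agent $j$'s current parameters and at the information it gets to know while all agents follow their current trajectories, started from the initial parameters $[\theta_j^0,w_j^0]$, produce exactly the same sequence of iterates. -/

import Mathlib

open scoped Topology

noncomputable section

namespace PersistentMonitoring

/-- The constants of the mission: `N` agents with sensing ranges `r j` and `M` targets at `x i` in
the mission space `[0, L]`, with uncertainty growth rates `A i` and decrease rates `B i`, over the
time horizon `[0, T]`. -/
structure Mission (N M : ℕ) where
  L : ℝ
  T : ℝ
  x : Fin M → ℝ
  r : Fin N → ℝ
  A : Fin M → ℝ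
  B : Fin M → ℝ
  T_pos : 0 < T
  x_mem : ∀ i, x i ∈ Set.Icc 0 L
  r_pos : ∀ j, 0 < r j
  A_pos : ∀ i, 0 < A i
  A_lt_B : ∀ i, A i < B i

/-- The parameters of one agent with `n` switching points: `φ (Sum.inl l)` is the switching point
`θ_{l+1}` and `φ (Sum.inr l)` is the dwell time `w_{l+1}` at it (`l = 0, …, n - 1`).  Gradients
with respect to these parameters have the same type. -/
abbrev AgentParams (n : ℕ) : Type := Fin n ⊕ Fin n → ℝ

/-- The joint parameters of all agents. -/
abbrev Params {N : ℕ} (Γ : Fin N → ℕ) : Type := ∀ j, AgentParams (Γ j)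

/-- The constraints: switching points in the mission space, nonnegative dwell times. -/
def Feasible {N M : ℕ} (m : Mission N M) {Γ : Fin N → ℕ} (φ : Params Γ) : Prop :=
  ∀ j l, φ j (Sum.inl l) ∈ Set.Icc 0 m.L ∧ 0 ≤ φ j (Sum.inr l)

/-! ### The trajectory of one agent -/

section Agent

variable {n : ℕ} (s₀ : ℝ) (φ : AgentParams n)

/-- `point l` is the `l`-th switching point, `point 0` being the initial position. -/
def point : ℕ → ℝ
  | 0 => s₀
  | l + 1 => if h : l < n then φ (Sum.inl ⟨l, h⟩) else point l

/-- Direction of the motion from the `l`-th to the `(l+1)`-st switching point. -/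
def dir (l : ℕ) : ℝ := Real.sign (point s₀ φ (l + 1) - point s₀ φ l)

/-- Dwell time at the `l`-th switching point. -/
def dwell : ℕ → ℝ
  | 0 => 0
  | l + 1 => if h : l < n then φ (Sum.inr ⟨l, h⟩) else 0

/-- Time at which the agent leaves the `l`-th switching point: it travels at unit speed and stays at
each switching point for its dwell time. -/
def depart : ℕ → ℝ
  | 0 => 0
  | l + 1 => depart l + |point s₀ φ (l + 1) - point s₀ φ l| + dwell φ (l + 1)

/-- Time at which the agent reaches the `l`-th switching point. -/
def arrive : ℕ → ℝ
  | 0 => 0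
  | l + 1 => depart s₀ φ l + |point s₀ φ (l + 1) - point s₀ φ l|

open Classical in
/-- The control `u(t) ∈ {-1, 0, 1}`.  Having reached its last switching point, the agent stays
there. -/
def agentControl (t : ℝ) : ℝ :=
  ∑ l : Fin n, if depart s₀ φ l ≤ t ∧ t < arrive s₀ φ (l + 1) then dir s₀ φ l else 0

/-- The position `s(t)`, given by `s' = u`, `s(0) = s₀`. -/
def position (t : ℝ) : ℝ := s₀ + ∫ τ in (0 : ℝ)..t, agentControl s₀ φ τ

/-- At the `l`-th switching point the control switches directly from `±1` to `∓1`, without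
dwelling. -/
def IsReversal (l : ℕ) : Prop :=
  dwell φ l = 0 ∧ dir s₀ φ (l - 1) ≠ 0 ∧ dir s₀ φ l = -dir s₀ φ (l - 1)

/-- IPA derivative of the position with respect to each parameter while the agent dwells at the
`l`-th switching point (set by the events `±1 → 0`). -/
def dwellSens (l : ℕ) : AgentParams n
  | Sum.inl k => if (k : ℕ) + 1 = l then 1 else 0
  | Sum.inr _ => 0

open Classical in
/-- IPA derivative of the position with respect to each parameter while the agent moves from the
`l`-th to the `(l+1)`-st switching point (set by the events `±1 → ∓1`, first alternative, and
`0 → ±1`, second alternative). -/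
def moveSens : ℕ → AgentParams n
  | 0, _ => 0
  | l + 1, Sum.inl k =>
      if IsReversal s₀ φ (l + 1) then
        if (k : ℕ) = l then 2 else if (k : ℕ) < l then -moveSens l (Sum.inl k) else 0
      else
        if (k : ℕ) = l then dwellSens (l + 1) (Sum.inl k) - dir s₀ φ (l + 1) * dir s₀ φ l
        else if (k : ℕ) < l then
          dwellSens (l + 1) (Sum.inl k) - dir s₀ φ (l + 1) * (dir s₀ φ k - dir s₀ φ (k + 1))
        else 0
  | l + 1, Sum.inr k =>
      if IsReversal s₀ φ (l + 1) then -moveSens l (Sum.inr k)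
      else if (k : ℕ) ≤ l then -dir s₀ φ (l + 1) else 0

open Classical in
/-- The IPA derivative of the position at time `t` with respect to each parameter: constant between
the control switches, right-continuous. -/
def sens (t : ℝ) : AgentParams n := fun c =>
  ∑ l : Fin n,
    ((if depart s₀ φ l ≤ t ∧ t < arrive s₀ φ (l + 1) then moveSens s₀ φ l c else 0) +
     (if arrive s₀ φ (l + 1) ≤ t ∧ (t < depart s₀ φ (l + 1) ∨ (l : ℕ) + 1 = n) then
        dwellSens (l + 1) c else 0))

end Agent

/-! ### Sensing, neighborhoods, target dynamics

Here `s j t` is the position of agent `j` at time `t`, and `R i t` the uncertainty of target `i`. -/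

section System

variable {N M : ℕ} (m : Mission N M) (s : Fin N → ℝ → ℝ) (R : Fin M → ℝ → ℝ)

/-- Linear-decay sensing model `p_{ij}(y) = max {0, 1 - |x_i - y| / r_j}`. -/
def sensing (i : Fin M) (j : Fin N) (y : ℝ) : ℝ := max 0 (1 - |m.x i - y| / m.r j)

open Classical in
/-- The derivative `∂p_{ij}/∂s_j ∈ {0, ±1/r_j}` (`0` at the two kinds of kinks). -/
def dSensing (i : Fin M) (j : Fin N) (y : ℝ) : ℝ :=
  if |m.x i - y| < m.r j then Real.sign (m.x i - y) / m.r j else 0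

/-- Joint detection probability `P_i(s(t))`. -/
def joint (i : Fin M) (t : ℝ) : ℝ := 1 - ∏ j, (1 - sensing m i j (s j t))

/-- Target neighborhood `T_j(t)` of agent `j`. -/
def targetNbhd (j : Fin N) (t : ℝ) : Set (Fin M) := {i | |m.x i - s j t| ≤ m.r j}

/-- Agent neighborhood `B_i(t)` of target `i`. -/
def agentNbhd (i : Fin M) (t : ℝ) : Set (Fin N) := {j | |s j t - m.x i| ≤ m.r j}

/-- Collaborators `N_{ij}(t) = B_i(t) \ {j}` of agent `j` in sensing target `i`. -/
def collab (i : Fin M) (j : Fin N) (t : ℝ) : Set (Fin N) := agentNbhd m s i t \ {j}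

open Classical in
/-- The uncertainties `R_i` on `[0, T]` from the initial values `R₀ i`: continuous, nonnegative,
and following the switched dynamics (at the switching times, in the sense of right derivatives). -/
structure IsUncertainty (R₀ : Fin M → ℝ) : Prop where
  init : ∀ i, R i 0 = R₀ i
  cont : ∀ i, ContinuousOn (R i) (Set.Icc 0 m.T)
  nonneg : ∀ i, ∀ t ∈ Set.Icc 0 m.T, 0 ≤ R i t
  dyn : ∀ i, ∀ t ∈ Set.Ico 0 m.T, HasDerivWithinAt (R i)
    (if R i t = 0 ∧ m.A i ≤ m.B i * joint m s i t then 0 else m.A i - m.B i * joint m s i t)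
    (Set.Ici t) t

/-! ### Events -/

/-- The events: `ρ_i^0`, `ρ_i^+`, `π_{ij}^0`, `π_{ij}^+`, `ν_j^{(u,v)}`, `Δ_{ij}^+`, `Δ_{ij}^-`. -/
inductive Event (N M : ℕ) : Type
  | rhoZero (i : Fin M)
  | rhoPlus (i : Fin M)
  | piZero (i : Fin M) (j : Fin N)
  | piPlus (i : Fin M) (j : Fin N)
  | nu (j : Fin N) (u v : SignType)
  | deltaPlus (i : Fin M) (j : Fin N)
  | deltaMinus (i : Fin M) (j : Fin N)

/-- The nonnegative signal `f` hits `0` at `t`: it vanishes at `t`, but not throughout any interval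
just before `t`. -/
def HitsZero (f : ℝ → ℝ) (t : ℝ) : Prop := f t = 0 ∧ ∃ᶠ τ in 𝓝[<] t, 0 < f τ

/-- The nonnegative signal `f` leaves `0` at `t`. -/
def LeavesZero (f : ℝ → ℝ) (t : ℝ) : Prop := f t = 0 ∧ ∃ᶠ τ in 𝓝[>] t, 0 < f τ

/-- The event occurs at the time `t ∈ (0, T)`; here `u j t` is the control of agent `j`. -/
def Occurs (u : Fin N → ℝ → ℝ) (t : ℝ) (e : Event N M) : Prop :=
  t ∈ Set.Ioo 0 m.T ∧
    match e with
    | .rhoZero i => HitsZero (R i) t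
    | .rhoPlus i => LeavesZero (R i) t
    | .piZero i j => HitsZero (fun τ => sensing m i j (s j τ)) t
    | .piPlus i j => LeavesZero (fun τ => sensing m i j (s j τ)) t
    | .nu j a b => a ≠ b ∧ (∀ᶠ τ in 𝓝[<] t, u j τ = (a : ℝ)) ∧ ∀ᶠ τ in 𝓝[>] t, u j τ = (b : ℝ)
    | .deltaPlus i j =>
        ∃ k, (∀ᶠ τ in 𝓝[<] t, k ∉ collab m s i j τ) ∧ ∀ᶠ τ in 𝓝[>] t, k ∈ collab m s i j τ
    | .deltaMinus i j =>
        ∃ k, (∀ᶠ τ in 𝓝[<] t, k ∈ collab m s i j τ) ∧ ∀ᶠ τ in 𝓝[>] t, k ∉ collab m s i j τ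

/-- The events `𝓔_j^A` of agent `j`. -/
def agentEvents (j : Fin N) : Set (Event N M) := {e | ∃ u v, e = .nu j u v}

/-- The events `𝓔_i^T` of target `i`. -/
def targetEvents (i : Fin M) : Set (Event N M) :=
  {e | e = .rhoZero i ∨ e = .rhoPlus i ∨
    ∃ j, e = .piZero i j ∨ e = .piPlus i j ∨ e = .deltaPlus i j ∨ e = .deltaMinus i j}

/-- The local event set `𝓔_j(t)` of agent `j`. -/
def localEvents (j : Fin N) (t : ℝ) : Set (Event N M) :=
  agentEvents j ∪ ⋃ i ∈ targetNbhd m s j t, targetEvents i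

/-- The local information set `I_j(t)` of agent `j`. -/
def infoSet (j : Fin N) (t : ℝ) : Set (Event N M) :=
  localEvents m s j t ∪ ⋃ i ∈ targetNbhd m s j t, ⋃ k ∈ collab m s i j t, localEvents m s k t

/-! ### What an agent gets to know -/

/-- What an agent gets to know at one time: occurring events, the states of some targets and the
positions of some agents (`none` for the others). -/
structure Observation (N M : ℕ) where
  events : Set (Event N M)
  target : Fin M → Option ℝ
  agent : Fin N → Option ℝ

open Classical in
/-- The limited information of agent `j` over the horizon.  At time `t` the agent gets to know
those events occurring at `t` that lie in its local information set `I_j(t)` or are a depletion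
event `ρ_i^0` of a target `i ∉ T_j(t)`; the states of the targets `i ∈ T_j(t)`; its own position,
and the positions of its current collaborators. -/
def record (u : Fin N → ℝ → ℝ) (j : Fin N) : Set.Icc 0 m.T → Observation N M := fun t =>
  { events := {e | Occurs m s R u t e ∧
      (e ∈ infoSet m s j t ∨ ∃ i, i ∉ targetNbhd m s j t ∧ e = .rhoZero i)}
    target := fun i => if i ∈ targetNbhd m s j t then some (R i t) else none
    agent := fun k =>
      if k = j ∨ ∃ i ∈ targetNbhd m s j t, k ∈ collab m s i j t then some (s k t) else none }

/-! ### The IPA gradient -/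

open Classical in
/-- `D` is the IPA derivative `t ↦ ∂R_i(t)/∂c` with respect to a scalar parameter `c` of agent `j`,
where `ds t` is the IPA derivative of `s_j(t)` with respect to `c`: it is integrated along the
target dynamics, continuous except at the events `ρ_i^0`, and is reset to `0` by these. -/
structure IsIPADeriv (i : Fin M) (j : Fin N) (ds : ℝ → ℝ) (D : ℝ → ℝ) : Prop where
  init : D 0 = 0
  reset : ∀ t ∈ Set.Ioo 0 m.T, HitsZero (R i) t → D t = 0
  leave : ∀ t ∈ Set.Ioo 0 m.T, LeavesZero (R i) t → D t = 0
  flow : ∀ a b, 0 ≤ a → a ≤ b → b ≤ m.T →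
    (∀ t ∈ Set.Ioc a b, t ∈ Set.Ioo 0 m.T → ¬ HitsZero (R i) t) →
    D b = D a - ∫ τ in a..b,
      if R i τ = 0 ∧ m.A i ≤ m.B i * joint m s i τ then 0
      else m.B i * (dSensing m i j (s j τ) * ds τ *
        ∏ g ∈ Finset.univ.filter (fun g => g ∈ collab m s i j τ), (1 - sensing m i g (s g τ)))

end System

/-! ### Gradient descent -/

section Descent

variable {N M : ℕ} (m : Mission N M) {Γ : Fin N → ℕ} (s₀ : Fin N → ℝ) (R₀ : Fin M → ℝ)

/-- The agent trajectories determined by the joint parameters. -/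
def positions (φ : Params Γ) : Fin N → ℝ → ℝ := fun j => position (s₀ j) (φ j)

/-- The agent controls determined by the joint parameters. -/
def controls (φ : Params Γ) : Fin N → ℝ → ℝ := fun j => agentControl (s₀ j) (φ j)

/-- `G` is the IPA gradient `∇J` at `φ` of the cost `J = (1/T) ∫_0^T ∑_i R_i(t) dt`, its component
`G j` being `∇_j J = (1/T) ∑_i ∫_0^T ∇_j R_i(t) dt`. -/
def IsCostGradient (φ G : Params Γ) : Prop :=
  ∃ (R : Fin M → ℝ → ℝ) (D : Fin M → ∀ j, Fin (Γ j) ⊕ Fin (Γ j) → ℝ → ℝ),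
    IsUncertainty m (positions s₀ φ) R R₀ ∧
    (∀ i j c, IsIPADeriv m (positions s₀ φ) R i j (fun t => sens (s₀ j) (φ j) t c) (D i j c)) ∧
    ∀ j c, G j c = 1 / m.T * ∑ i, ∫ t in (0 : ℝ)..m.T, D i j c t

/-- One step of agent `j`, in the direction `-g`, with step size `αθ` for the switching points and
`αw` for the dwell times. -/
def step {n : ℕ} (αθ αw : ℝ) (φ g : AgentParams n) : AgentParams n :=
  fun c => φ c - Sum.elim (fun _ => αθ) (fun _ => αw) c * g c

/-- The first `K` steps (all steps, for `K = ⊤`) of `φ` are centralized gradient descent on `J`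
through feasible parameters. -/
def IsCentralizedRun (αθ αw : ℕ → ℝ) (K : ℕ∞) (φ : ℕ → Params Γ) : Prop :=
  ∀ l : ℕ, (l : ℕ∞) < K → Feasible m (φ l) ∧
    ∃ G : Params Γ, IsCostGradient m s₀ R₀ (φ l) G ∧
      ∀ j, φ (l + 1) j = step (αθ l) (αw l) (φ l j) (G j)

/-- A family of local gradient estimators: agent `j` knows only its own current parameters and its
own limited information. -/
abbrev Estimator (Γ : Fin N → ℕ) : Type :=
  ∀ j, AgentParams (Γ j) → (Set.Icc 0 m.T → Observation N M) → AgentParams (Γ j)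

/-- The first `K` steps (all steps, for `K = ⊤`) of `ψ` are the decentralized per-agent updates with
the estimators `F`: in each iteration the agents follow their current trajectories, and each one
updates its own parameters from what it got to know meanwhile. -/
def IsDecentralizedRun (F : Estimator m Γ) (αθ αw : ℕ → ℝ) (K : ℕ∞) (ψ : ℕ → Params Γ) : Prop :=
  ∀ l : ℕ, (l : ℕ∞) < K →
    ∃ R : Fin M → ℝ → ℝ, IsUncertainty m (positions s₀ (ψ l)) R R₀ ∧
      ∀ j, ψ (l + 1) j = step (αθ l) (αw l) (ψ l j)
        (F j (ψ l j) (record m (positions s₀ (ψ l)) R (controls s₀ (ψ l)) j))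

end Descent

end PersistentMonitoring

end

open PersistentMonitoring

open scoped Topology

noncomputable section

namespace PersistentMonitoring

/-! The derivative of `R i` with respect to a parameter of agent `j` restarts from `0` at every
depletion of target `i`, and in between its rate carries the factor `∂p_{ij}/∂s_j`, which vanishes
while the target is out of range. In range, the agent sees `R i`, its own position and its
collaborators; all other agents contribute the factor `1`, so the rate is computable
(`observedRate_record`). Out of range, only the depletion times matter, and these are announced
(`rhoZero_mem_record`). Hence the derivative at `t` is minus the integral of a locally known rate
since the last reset (`IsIPADeriv.eq_observedDeriv`).

The gradient and the decentralized run each come with their own uncertainties. The switched rate is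
nonincreasing in the state, which forces uniqueness (`IsUncertainty.eqOn`), so both see the same
data. Induction on the iteration then identifies the runs. -/

/-! ### Uniqueness of the uncertainties -/

section Uniqueness

variable {N M : ℕ} {m : Mission N M} {s : Fin N → ℝ → ℝ} {R R' : Fin M → ℝ → ℝ} {R₀ : Fin M → ℝ}

open Classical in
/-- The switched right-hand side `f y = if y = 0 ∧ d ≤ 0 then 0 else d` (with `d = a - b`) is
nonincreasing on `[0, ∞)`. -/
lemma switched_rate_antitone {a b y y' : ℝ} (hy : 0 ≤ y) (hy' : 0 ≤ y') :
    (y - y') * ((if y = 0 ∧ a ≤ b then 0 else a - b) -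
      (if y' = 0 ∧ a ≤ b then 0 else a - b)) ≤ 0 := by
  split_ifs with h h' h'
  · simp
  · nlinarith [h.1, h.2]
  · nlinarith [h'.1, h'.2]
  · simp

/-- The initial uncertainties and the trajectories determine the uncertainties on `[0, T]`. -/
theorem IsUncertainty.eqOn (h : IsUncertainty m s R R₀) (h' : IsUncertainty m s R' R₀)
    (i : Fin M) : Set.EqOn (R i) (R' i) (Set.Icc 0 m.T) := by
  intro t ht
  -- The rate is discontinuous in the state, but monotonicity is enough: the squared difference
  -- starts at `0` and has nonpositive right derivative.
  have key := image_le_of_deriv_right_le_deriv_boundary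
    (f := fun t => (R i t - R' i t) ^ 2) (a := 0) (b := m.T)
    (((h.cont i).sub (h'.cont i)).pow 2)
    (fun t ht => ((h.dyn i t ht).sub (h'.dyn i t ht)).pow 2)
    (B := fun _ => 0) (B' := fun _ => 0) (by simp [h.init i, h'.init i]) continuousOn_const
    (fun t _ => hasDerivWithinAt_const _ _ _)
    (fun t ht => by
      have := switched_rate_antitone (a := m.A i) (b := m.B i * joint m s i t)
        (h.nonneg i t (Set.Ico_subset_Icc_self ht)) (h'.nonneg i t (Set.Ico_subset_Icc_self ht))
      simp only [Pi.sub_apply, Nat.cast_ofNat, Nat.add_one_sub_one, pow_one]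
      linarith)
    ht
  exact sub_eq_zero.1 (pow_eq_zero_iff two_ne_zero |>.1 (le_antisymm key (sq_nonneg _)))

/-- Since `t` is interior, agreement on `[0, T]` covers a neighborhood of `t`. -/
lemma hitsZero_congr {T : ℝ} {f g : ℝ → ℝ} (h : Set.EqOn f g (Set.Icc 0 T)) {t : ℝ}
    (ht : t ∈ Set.Ioo 0 T) : HitsZero f t ↔ HitsZero g t := by
  unfold HitsZero
  rw [h (Set.Ioo_subset_Icc_self ht), Filter.frequently_congr]
  filter_upwards [nhdsWithin_le_nhds (Icc_mem_nhds ht.1 ht.2)] with τ hτ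
  rw [h hτ]

lemma leavesZero_congr {T : ℝ} {f g : ℝ → ℝ} (h : Set.EqOn f g (Set.Icc 0 T)) {t : ℝ}
    (ht : t ∈ Set.Ioo 0 T) : LeavesZero f t ↔ LeavesZero g t := by
  unfold LeavesZero
  rw [h (Set.Ioo_subset_Icc_self ht), Filter.frequently_congr]
  filter_upwards [nhdsWithin_le_nhds (Icc_mem_nhds ht.1 ht.2)] with τ hτ
  rw [h hτ]

lemma occurs_congr (h : ∀ i, Set.EqOn (R i) (R' i) (Set.Icc 0 m.T)) (u : Fin N → ℝ → ℝ) (t : ℝ)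
    (e : Event N M) : Occurs m s R u t e ↔ Occurs m s R' u t e := by
  unfold Occurs
  refine and_congr_right fun ht => ?_
  cases e with
  | rhoZero i => exact hitsZero_congr (h i) ht
  | rhoPlus i => exact leavesZero_congr (h i) ht
  | _ => exact Iff.rfl

/-- What an agent gets to know depends only on the uncertainties on `[0, T]`. -/
lemma record_congr (h : ∀ i, Set.EqOn (R i) (R' i) (Set.Icc 0 m.T)) (u : Fin N → ℝ → ℝ)
    (j : Fin N) : record m s R u j = record m s R' u j := by
  funext t
  simp only [record, occurs_congr h, h _ t.2]

end Uniqueness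

/-! ### The estimator -/

section Estimation

variable {N M : ℕ} (m : Mission N M)

/-- Factor `1 - p_{ik}(s_k)` of an observed agent; an agent which is not observed contributes the
factor `1`. -/
def observedFactor (o : Observation N M) (i : Fin M) (k : Fin N) : ℝ :=
  (o.agent k).elim 1 fun y => 1 - sensing m i k y

open Classical in
/-- The negative rate of change of `∂R_i/∂c` computed by agent `j` from an observation, where `ds`
is the derivative of its position with respect to `c`. -/
def observedRate (o : Observation N M) (i : Fin M) (j : Fin N) (ds : ℝ) : ℝ :=
  -- The default `0` is the true rate for an unseen target, as `∂p_{ij}/∂s_j` vanishes out of range.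
  (o.target i).elim 0 fun ρ =>
    if ρ = 0 ∧ m.A i ≤ m.B i * (1 - ∏ k, observedFactor m o i k) then 0
    else m.B i * (dSensing m i j ((o.agent j).getD 0) * ds *
      ∏ g ∈ Finset.univ.erase j, observedFactor m o i g)

variable {m}

/-- The observations as a function on the real line. -/
def observedAt (rec : Set.Icc 0 m.T → Observation N M) : ℝ → Observation N M :=
  Set.IccExtend m.T_pos.le rec

/-- Times up to `t` at which target `i` is known to be depleted. -/
def observedHits (rec : Set.Icc 0 m.T → Observation N M) (i : Fin M) (t : ℝ) : Set ℝ :=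
  {τ | τ ∈ Set.Ioc 0 t ∧ Event.rhoZero i ∈ (observedAt rec τ).events}

/-- The last reset of `∂R_i/∂c` up to time `t`, or `0` if there was none. -/
def lastReset (rec : Set.Icc 0 m.T → Observation N M) (i : Fin M) (t : ℝ) : ℝ :=
  -- Time `0` counts as a reset because the derivative starts from `0`.
  sSup (insert 0 (observedHits rec i t))

/-- The derivative `∂R_i/∂c (t)` computed by agent `j` from its parameters and its information. -/
def observedDeriv {n : ℕ} (j : Fin N) (p : AgentParams n)
    (rec : Set.Icc 0 m.T → Observation N M) (i : Fin M) (c : Fin n ⊕ Fin n) (t : ℝ) : ℝ :=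
  -∫ τ in lastReset rec i t..t,
    -- `sens` needs the initial position, which the agent reads off as its own position at time `0`.
    observedRate m (observedAt rec τ) i j (sens (((observedAt rec 0).agent j).getD 0) p τ c)

variable (m) in
/-- The estimator of `∇_j J` by agent `j` from its parameters and its information. -/
def localGradient (Γ : Fin N → ℕ) : Estimator m Γ := fun j p rec c =>
  1 / m.T * ∑ i, ∫ t in (0 : ℝ)..m.T, observedDeriv j p rec i c t

end Estimation

/-! ### Correctness of the locally computed derivatives. -/

section Correctness

variable {N M : ℕ} {m : Mission N M} {s : Fin N → ℝ → ℝ} {R : Fin M → ℝ → ℝ}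
  {u : Fin N → ℝ → ℝ} {i : Fin M} {j : Fin N}

lemma sensing_eq_zero_of_notMem_agentNbhd {k : Fin N} {t : ℝ} (h : k ∉ agentNbhd m s i t) :
    sensing m i k (s k t) = 0 := by
  simp only [agentNbhd, Set.mem_ofPred_eq, not_le, abs_sub_comm (s k t)] at h
  have := (one_lt_div (m.r_pos k)).2 h
  exact max_eq_left (by linarith)

lemma dSensing_eq_zero_of_notMem_targetNbhd {t : ℝ} (h : i ∉ targetNbhd m s j t) :
    dSensing m i j (s j t) = 0 := by
  simp only [targetNbhd, Set.mem_ofPred_eq] at h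
  exact if_neg fun h' => h h'.le

/-- With target `i` in range, any other agent sensing it would be an observed collaborator. An
unobserved agent therefore has detection probability `0`, matching the default factor `1`. -/
lemma observedFactor_record {t : Set.Icc 0 m.T} (hi : i ∈ targetNbhd m s j t) (k : Fin N) :
    observedFactor m (record m s R u j t) i k = 1 - sensing m i k (s k t) := by
  by_cases hk : k = j ∨ ∃ i ∈ targetNbhd m s j t, k ∈ collab m s i j t
  · simp [observedFactor, record, if_pos hk]
  · have hk' : k ∉ agentNbhd m s i t := fun h =>
      hk (or_iff_not_imp_left.2 fun hne => ⟨i, hi, h, hne⟩)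
    simp [observedFactor, record, if_neg hk, sensing_eq_zero_of_notMem_agentNbhd hk']

lemma agent_record_self (t : Set.Icc 0 m.T) :
    ((record m s R u j t).agent j).getD 0 = s j t := by
  simp [record]

open Classical in
/-- The rate of change of `∂R_i/∂c` is known to agent `j` also outside its sensing range, where it
vanishes. -/
lemma observedRate_record (t : Set.Icc 0 m.T) (ds : ℝ) :
    observedRate m (record m s R u j t) i j ds =
      if R i t = 0 ∧ m.A i ≤ m.B i * joint m s i t then 0
      else m.B i * (dSensing m i j (s j t) * ds *
        ∏ g ∈ Finset.univ.filter (fun g => g ∈ collab m s i j t),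
          (1 - sensing m i g (s g t))) := by
  by_cases hi : i ∈ targetNbhd m s j t
  · have htarget : (record m s R u j t).target i = some (R i t) := if_pos hi
    have hprod : ∏ g ∈ Finset.univ.erase j, (1 - sensing m i g (s g t)) =
        ∏ g ∈ Finset.univ.filter (fun g => g ∈ collab m s i j t),
          (1 - sensing m i g (s g t)) := by
      symm
      refine Finset.prod_subset (fun g hg => ?_) fun g hg hg' => ?_
      · simpa using (Finset.mem_filter.1 hg).2.2
      · have : g ∉ agentNbhd m s i t := fun h =>
          hg' (Finset.mem_filter.2 ⟨Finset.mem_univ _, h, (Finset.mem_erase.1 hg).1⟩)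
        rw [sensing_eq_zero_of_notMem_agentNbhd this, sub_zero]
    simp only [observedRate, htarget, Option.elim_some, observedFactor_record hi,
      agent_record_self, hprod, joint]
    congr
  · have htarget : (record m s R u j t).target i = none := if_neg hi
    simp [observedRate, htarget, dSensing_eq_zero_of_notMem_targetNbhd hi]

lemma observedAt_record {t : ℝ} (ht : t ∈ Set.Icc 0 m.T) :
    observedAt (record m s R u j) t = record m s R u j ⟨t, ht⟩ :=
  Set.IccExtend_of_mem _ _ ht

/-- Every depletion of a target is known to agent `j`. -/
lemma rhoZero_mem_record {t : ℝ} (ht : t ∈ Set.Ioo 0 m.T) :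
    Event.rhoZero i ∈ (observedAt (record m s R u j) t).events ↔ HitsZero (R i) t := by
  rw [observedAt_record (Set.Ioo_subset_Icc_self ht)]
  refine ⟨fun h => h.1.2, fun h => ⟨⟨ht, h⟩, ?_⟩⟩
  -- In range the event lies in `I_j(t)`; out of range the extra knowledge of depletions is
  -- indispensable to this argument.
  by_cases hi : i ∈ targetNbhd m s j t
  · exact Or.inl (Or.inl (Or.inr (Set.mem_biUnion hi (Or.inl rfl))))
  · exact Or.inr ⟨i, hi, rfl⟩

/-- The bound on `t` is strict because events are recorded only in the open interval `(0, T)`. -/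
lemma observedHits_record {t : ℝ} (ht : t < m.T) :
    observedHits (record m s R u j) i t = {τ | τ ∈ Set.Ioc 0 t ∧ HitsZero (R i) τ} := by
  ext τ
  exact and_congr_right fun hτ => rhoZero_mem_record ⟨hτ.1, hτ.2.trans_lt ht⟩

/-- A continuous signal hits `0` at the last of the times up to `t` at which it does so, if any:
accumulation points from the left of such times are of the same kind. -/
lemma hitsZero_csSup {f : ℝ → ℝ} {t : ℝ} (hf : ContinuousOn f (Set.Icc 0 t))
    (hne : {τ | τ ∈ Set.Ioc 0 t ∧ HitsZero f τ}.Nonempty) :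
    sSup {τ | τ ∈ Set.Ioc 0 t ∧ HitsZero f τ} ∈ {τ | τ ∈ Set.Ioc 0 t ∧ HitsZero f τ} := by
  set H := {τ | τ ∈ Set.Ioc 0 t ∧ HitsZero f τ} with hH
  have hlub : IsLUB H (sSup H) := isLUB_csSup hne ⟨t, fun τ hτ => hτ.1.2⟩
  by_contra hmem
  obtain ⟨τ₀, hτ₀⟩ := hne
  have hsup : sSup H ∈ Set.Ioc 0 t :=
    ⟨hτ₀.1.1.trans_le (hlub.1 hτ₀), hlub.2 fun τ hτ => hτ.1.2⟩
  refine hmem ⟨hsup, ?_, ?_⟩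
  · have hclos : sSup H ∈ closure H := hlub.mem_closure ⟨τ₀, hτ₀⟩
    have hsub : H ⊆ Set.Icc 0 t := fun τ hτ => Set.Ioc_subset_Icc_self hτ.1
    have := (hf _ (Set.Ioc_subset_Icc_self hsup)).mono hsub |>.mem_closure_image hclos
    have himg : f '' H ⊆ {0} := by
      rintro _ ⟨τ, hτ, rfl⟩
      exact hτ.2.1
    simpa using closure_mono himg this
  -- Beyond any `a` below the supremum there is a hitting time `τ`, and positive values of `f` occur
  -- in `(a, τ)`, just before it.
  · refine (nhdsLT_basis (sSup H)).frequently_iff.2 fun a ha => ?_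
    obtain ⟨τ, hτ, haτ, hτle⟩ := hlub.exists_between ha
    obtain ⟨y, hy, hay, hyτ⟩ :=
      (hτ.2.2.and_eventually (Ioo_mem_nhdsLT haτ)).exists
    exact ⟨y, ⟨hay, hyτ.trans_le hτle⟩, hy⟩

/-- The last reset is a depletion time or the initial time, and no depletion follows it. -/
lemma lastReset_record {t : ℝ} (ht : t ∈ Set.Ico 0 m.T) (hR : ContinuousOn (R i) (Set.Icc 0 m.T)) :
    (lastReset (record m s R u j) i t = 0 ∨
      lastReset (record m s R u j) i t ∈ Set.Ioc 0 t ∧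
        HitsZero (R i) (lastReset (record m s R u j) i t)) ∧
    ∀ τ ∈ Set.Ioc (lastReset (record m s R u j) i t) t, 0 < τ → ¬ HitsZero (R i) τ := by
  rw [lastReset, observedHits_record ht.2]
  set H := {τ | τ ∈ Set.Ioc 0 t ∧ HitsZero (R i) τ} with hH
  have hbdd : BddAbove H := ⟨t, fun τ hτ => hτ.1.2⟩
  refine ⟨?_, fun τ hτ hpos hhit =>
    hτ.1.not_ge (le_csSup (hbdd.insert 0) (Or.inr ⟨⟨hpos, hτ.2⟩, hhit⟩))⟩
  rcases H.eq_empty_or_nonempty with he | hne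
  · left
    simp [he]
  · right
    have hmem := hitsZero_csSup (hR.mono (Set.Icc_subset_Icc_right ht.2.le)) hne
    have hins : sSup (insert 0 H) = sSup H := by
      rw [csSup_insert hbdd hne]
      exact sup_eq_right.2 hmem.1.1.le
    rw [hins]
    exact hmem

/-- Agent `j` computes `∂R_i/∂c` correctly from its information. -/
theorem IsIPADeriv.eq_observedDeriv {n : ℕ} {s₀ : ℝ} {p : AgentParams n} {c : Fin n ⊕ Fin n}
    {D : ℝ → ℝ} (hD : IsIPADeriv m s R i j (fun t => sens s₀ p t c) D)
    (hs : s j = position s₀ p) (hR : ContinuousOn (R i) (Set.Icc 0 m.T))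
    {t : ℝ} (ht : t ∈ Set.Ico 0 m.T) :
    D t = observedDeriv j p (record m s R u j) i c t := by
  obtain ⟨hzero, hlast⟩ := lastReset_record (s := s) (u := u) (j := j) ht hR
  have hs₀ : ((observedAt (record m s R u j) 0).agent j).getD 0 = s₀ := by
    rw [observedAt_record (Set.left_mem_Icc.2 m.T_pos.le), agent_record_self, hs]
    simp [position]
  rw [observedDeriv, hs₀]
  set a := lastReset (record m s R u j) i t with ha
  have ha0 : 0 ≤ a := hzero.elim (fun h => h.ge) fun h => h.1.1.le
  have hat : a ≤ t := hzero.elim (fun h => h.trans_le ht.1) fun h => h.1.2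
  have hDa : D a = 0 := hzero.elim (fun h => h ▸ hD.init) fun h =>
    hD.reset a ⟨h.1.1, h.1.2.trans_lt ht.2⟩ h.2
  -- `flow` forbids hits only on `(a, t]`, so it may start at the reset time `a` itself.
  rw [hD.flow a t ha0 hat ht.2.le fun τ hτ hτ' => hlast τ hτ hτ'.1, hDa, zero_sub]
  congr 1
  refine intervalIntegral.integral_congr fun τ hτ => ?_
  rw [Set.uIcc_of_le hat] at hτ
  have hτ' : τ ∈ Set.Icc 0 m.T := ⟨ha0.trans hτ.1, hτ.2.trans ht.2.le⟩
  rw [observedAt_record hτ', observedRate_record]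

end Correctness

/-! ### From derivatives to the cost gradient. -/

section Descent

variable {N M : ℕ} {m : Mission N M} {Γ : Fin N → ℕ} {s₀ : Fin N → ℝ} {R₀ : Fin M → ℝ}

/-- The estimators compute the IPA gradient from the local information. -/
theorem IsCostGradient.eq_localGradient {φ G : Params Γ} (hG : IsCostGradient m s₀ R₀ φ G)
    {R : Fin M → ℝ → ℝ} (hR : IsUncertainty m (positions s₀ φ) R R₀) (j : Fin N) :
    localGradient m Γ j (φ j) (record m (positions s₀ φ) R (controls s₀ φ) j) = G j := by
  obtain ⟨R', D, hR', hD, hG⟩ := hG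
  rw [record_congr (fun i => hR.eqOn hR' i)]
  funext c
  rw [hG, localGradient]
  congr 1
  refine Finset.sum_congr rfl fun i _ => ?_
  refine intervalIntegral.integral_congr_ae ?_
  -- A hit at the final time is not recorded; this single instant does not affect the integral.
  have hT : ∀ᵐ t : ℝ, t ≠ m.T := by simp [MeasureTheory.ae_iff]
  filter_upwards [hT] with t htT ht
  rw [Set.uIoc_of_le m.T_pos.le] at ht
  exact ((hD i j c).eq_observedDeriv rfl (hR'.cont i) ⟨ht.1.le, ht.2.lt_of_ne htT⟩).symm

end Descent

end PersistentMonitoring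

end

theorem theorem1 {N M : ℕ} (m : Mission N M) (Γ : Fin N → ℕ) :
    ∃ F : Estimator m Γ,
      ∀ (s₀ : Fin N → ℝ) (R₀ : Fin M → ℝ), (∀ j, s₀ j ∈ Set.Icc 0 m.L) → (∀ i, 0 ≤ R₀ i) →
      ∀ (αθ αw : ℕ → ℝ) (K : ℕ∞) (φ : ℕ → Params Γ),
        IsCentralizedRun m s₀ R₀ αθ αw K φ →
        IsDecentralizedRun m s₀ R₀ F αθ αw K φ ∧
        ∀ ψ : ℕ → Params Γ, (∀ j, ψ 0 j = φ 0 j) → IsDecentralizedRun m s₀ R₀ F αθ αw K ψ →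
          ∀ l : ℕ, (l : ℕ∞) ≤ K → ψ l = φ l := by
  refine ⟨localGradient m Γ, fun s₀ R₀ _ _ αθ αw K φ hφ => ⟨fun l hl => ?_, fun ψ h0 hψ l => ?_⟩⟩
  · obtain ⟨_, G, hG, hstep⟩ := hφ l hl
    -- The uncertainties underlying the centralized gradient also serve as those of the
    -- decentralized run.
    obtain ⟨R, _, hR, _, _⟩ := id hG
    exact ⟨R, hR, fun j => by rw [hstep, hG.eq_localGradient hR]⟩
  · induction l with
    | zero => exact fun _ => funext h0
    | succ l ih =>
      intro hl
      have hlt : (l : ℕ∞) < K := (Nat.cast_lt.2 l.lt_succ_self).trans_le hl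
      obtain ⟨_, G, hG, hstep⟩ := hφ l hlt
      obtain ⟨R, hR, hstep'⟩ := hψ l hlt
      -- Equal parameters give equal trajectories, so the estimators act on the records of the
      -- centralized iterate.
      rw [ih hlt.le] at hR hstep'
      funext j
      rw [hstep', hstep, hG.eq_localGradient hR]
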